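/- Consider scheduling with testing on a single machine. An instance consists of $n$ jobs; job $j$ has a testing time $t_j\ge 0$, an upper bound $u_j$ and a processing time $p_j$ with $0\le p_j\le u_j$. A job is completed either by running it untested, which takes time $u_j$, or by testing it, which takes time $t_j$, and executing it, at any time after the test is finished, which takes time $p_j$. Preemption is allowed: the machine may interrupt any operation at any time, work on another one, and continue the interrupted operation later. A deterministic online algorithm knows $n$, all $t_j$ and all $u_j$ from the start, but learns $p_j$ only when the test of job $j$ is finished. The objective is to minimize the sum of completion times $\sum_j C_j$, and an algorithm is called $c$-competitive if on every instance the sum of completion times of its schedule is at most $c$ times the optimal offline value (the infimum of $\sum_j C_j$ over all preemptive schedules for that instance with all $p_j$ known). Then no deterministic preemptive algorithm is better than $1.8546$-competitive: if a deterministic preemptive online algorithm is $c$-competitive, then $c\ge 1.8546$. -/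

import Mathlib

open scoped NNReal ENNReal

namespace SchedulingWithTesting

/-- An instance of scheduling with testing on a single machine, with `n` jobs. Job `j` has a
testing time `t j ≥ 0`, an upper bound `u j`, and a processing time `p j` with
`0 ≤ p j ≤ u j`. -/
structure Instance (n : ℕ) where
  /-- the testing times -/
  t : Fin n → ℝ≥0
  /-- the upper bounds -/
  u : Fin n → ℝ≥0
  /-- the processing times -/
  p : Fin n → ℝ≥0
  /-- every processing time respects the upper bound -/
  p_le_u : ∀ j, p j ≤ u j

/-- A preemptive schedule on a single machine, given by the machine time that each operation has
received up to time `s`. Every job has three possible operations: it can be tested, run untested,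
or (after its test) executed. An operation may be interrupted at any time in favour of any other
one, and continued later. The machine has unit speed: in a time interval `[s, s']` it does at
most `s' - s` units of work altogether (it may idle). The usual schedules, in which the machine
works on at most one operation at any time, satisfy these conditions, and so do the limits of
such schedules in which the machine is shared by several operations (round robin with
infinitesimal time units). -/
structure Schedule {n : ℕ} (I : Instance n) where
  /-- time spent on the test of job `j` up to time `s` -/
  testWork : Fin n → ℝ≥0 → ℝ≥0
  /-- time spent on running job `j` untested up to time `s` -/
  untestedWork : Fin n → ℝ≥0 → ℝ≥0
  /-- time spent on executing the tested job `j` up to time `s` -/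
  execWork : Fin n → ℝ≥0 → ℝ≥0
  testWork_zero : ∀ j, testWork j 0 = 0
  untestedWork_zero : ∀ j, untestedWork j 0 = 0
  execWork_zero : ∀ j, execWork j 0 = 0
  testWork_mono : ∀ j, Monotone (testWork j)
  untestedWork_mono : ∀ j, Monotone (untestedWork j)
  execWork_mono : ∀ j, Monotone (execWork j)
  /-- the machine does at most `s' - s` units of work between the times `s` and `s'` -/
  unit_speed : ∀ s s' : ℝ≥0, s ≤ s' →
    ∑ j, (testWork j s' + untestedWork j s' + execWork j s') + s ≤
      ∑ j, (testWork j s + untestedWork j s + execWork j s) + s'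
  /-- the execution of a tested job cannot start before its test is finished -/
  exec_after_test : ∀ j s, testWork j s < I.t j → execWork j s = 0

namespace Schedule

variable {n : ℕ} {I : Instance n}

/-- The test of job `j` is finished at time `s`. -/
def Tested (S : Schedule I) (j : Fin n) (s : ℝ≥0) : Prop :=
  I.t j ≤ S.testWork j s

/-- Job `j` is finished at time `s`: it has been run untested, for `u j` units of time, or it has
been tested, for `t j` units of time, and then executed, for `p j` units of time. -/
def Finished (S : Schedule I) (j : Fin n) (s : ℝ≥0) : Prop :=
  I.u j ≤ S.untestedWork j s ∨ (S.Tested j s ∧ I.p j ≤ S.execWork j s)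

/-- The completion time of job `j`; it is `∞` if the job is never finished. -/
noncomputable def completionTime (S : Schedule I) (j : Fin n) : ℝ≥0∞ :=
  ⨅ (s : ℝ≥0) (_ : S.Finished j s), (s : ℝ≥0∞)

/-- The sum of the completion times of all jobs. -/
noncomputable def cost (S : Schedule I) : ℝ≥0∞ :=
  ∑ j, S.completionTime j

end Schedule

/-- The value of an optimal offline solution: the infimum of the sum of completion times over
all schedules for the (completely known) instance. -/
noncomputable def Instance.opt {n : ℕ} (I : Instance n) : ℝ≥0∞ :=
  ⨅ S : Schedule I, S.cost

/-- A deterministic preemptive online algorithm. It knows the number of jobs, the testing times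
and the upper bounds from the start, but learns the processing time of a job only when the test
of this job is finished. Hence, if two instances differ only in the processing times, and
differ in these only for jobs whose test is not finished before time `r`, then the algorithm must
behave in the same way on both instances up to time `r`. -/
structure PreemptiveAlgorithm where
  /-- the schedule that the algorithm produces on an instance -/
  schedule : ∀ {n : ℕ} (I : Instance n), Schedule I
  nonanticipating : ∀ {n : ℕ} (I I' : Instance n), I.t = I'.t → I.u = I'.u → ∀ r : ℝ≥0,
    (∀ j, ∀ s < r, (schedule I).Tested j s → I.p j = I'.p j) →
    ∀ s ≤ r, ∀ j,
      (schedule I).testWork j s = (schedule I').testWork j s ∧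
      (schedule I).untestedWork j s = (schedule I').untestedWork j s ∧
      (schedule I).execWork j s = (schedule I').execWork j s

/-- The algorithm is `c`-competitive for the sum of completion times: on every instance its cost
is at most `c` times the optimal offline value. -/
def PreemptiveAlgorithm.IsCompetitive (A : PreemptiveAlgorithm) (c : ℝ) : Prop :=
  ∀ (n : ℕ) (I : Instance n), (A.schedule I).cost ≤ ENNReal.ofReal c * I.opt

end SchedulingWithTesting

namespace SchedulingWithTesting

/-! An adversary uses `n` jobs with testing time 1 and upper bound `u` slightly below 2. Among the
first 63.07% of jobs whose test or untested run finishes, a tested job gets processing time `u` (the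
test was wasted) and an untested one gets 0 (a test would have sufficed); all later jobs get 0.
`exists_handledAt` constructs this answer.

With `B` the set of tested early jobs, running `B` untested and testing the rest, shortest first,
gives `2 * opt ≤ n² + (u-1)|B|² + O(n)`. For the algorithm, `2 * ∑ C j` is at least the sum over
pairs of the work each job has received when the other completes. Bounding each pair by its types
gives `exists_card_le_cost`, which leaves open how many jobs of `B` are completed early (`z`) or
late (`y`); `quadratic_bound` settles all choices. -/

/-! ### Continuity of work, and attained completion times -/

/-- Such an `f` is 1-Lipschitz. Continuity makes the sets of times at which a threshold is reached
closed, so first times exist. -/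
theorem continuous_of_monotone_of_unit_speed {f : ℝ≥0 → ℝ≥0} (hf : Monotone f)
    (h : ∀ s s', s ≤ s' → f s' + s ≤ f s + s') : Continuous f := by
  have key : ∀ s s' : ℝ≥0, s ≤ s' → dist (f s) (f s') ≤ dist s s' := by
    intro s s' hs
    have h1 := hf hs
    have h2 := h s s' hs
    rw [NNReal.dist_eq, NNReal.dist_eq]
    rw [← NNReal.coe_le_coe] at hs h1 h2
    push_cast at h2
    rw [abs_sub_comm, abs_of_nonneg (by linarith), abs_sub_comm, abs_of_nonneg (by linarith)]
    linarith
  refine (LipschitzWith.of_dist_le_mul (K := 1) fun s s' => ?_).continuous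
  rw [NNReal.coe_one, one_mul]
  rcases le_total s s' with hs | hs
  · exact key s s' hs
  · rw [dist_comm, dist_comm s]
    exact key s' s hs

namespace Schedule

variable {n : ℕ} {I : Instance n}

/-- The total machine time that job `j` has received up to time `s`. -/
def work (S : Schedule I) (j : Fin n) (s : ℝ≥0) : ℝ≥0 :=
  S.testWork j s + S.untestedWork j s + S.execWork j s

theorem work_mono (S : Schedule I) (j : Fin n) : Monotone (S.work j) := fun _ _ h =>
  add_le_add (add_le_add (S.testWork_mono j h) (S.untestedWork_mono j h)) (S.execWork_mono j h)

theorem sum_work_le (S : Schedule I) (s : ℝ≥0) : ∑ j, S.work j s ≤ s := by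
  simpa [work, S.testWork_zero, S.untestedWork_zero, S.execWork_zero] using S.unit_speed 0 s zero_le

theorem work_unit_speed (S : Schedule I) (j : Fin n) {s s' : ℝ≥0} (h : s ≤ s') :
    S.work j s' + s ≤ S.work j s + s' := by
  have h1 : ∑ k, S.work k s' + s ≤ ∑ k, S.work k s + s' := S.unit_speed s s' h
  rw [← Finset.add_sum_erase _ _ (Finset.mem_univ j),
    ← Finset.add_sum_erase _ (fun k => S.work k s) (Finset.mem_univ j)] at h1
  have h2 : ∑ k ∈ Finset.univ.erase j, S.work k s ≤ ∑ k ∈ Finset.univ.erase j, S.work k s' :=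
    Finset.sum_le_sum fun k _ => S.work_mono k h
  rw [← NNReal.coe_le_coe] at *
  push_cast at *
  linarith

theorem continuous_testWork (S : Schedule I) (j : Fin n) : Continuous (S.testWork j) := by
  refine continuous_of_monotone_of_unit_speed (S.testWork_mono j) fun s s' h => ?_
  have h1 := S.work_unit_speed j h
  have h2 := S.untestedWork_mono j h
  have h3 := S.execWork_mono j h
  unfold work at h1
  rw [← NNReal.coe_le_coe] at *
  push_cast at *
  linarith

theorem continuous_untestedWork (S : Schedule I) (j : Fin n) : Continuous (S.untestedWork j) := by
  refine continuous_of_monotone_of_unit_speed (S.untestedWork_mono j) fun s s' h => ?_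
  have h1 := S.work_unit_speed j h
  have h2 := S.testWork_mono j h
  have h3 := S.execWork_mono j h
  unfold work at h1
  rw [← NNReal.coe_le_coe] at *
  push_cast at *
  linarith

theorem continuous_execWork (S : Schedule I) (j : Fin n) : Continuous (S.execWork j) := by
  refine continuous_of_monotone_of_unit_speed (S.execWork_mono j) fun s s' h => ?_
  have h1 := S.work_unit_speed j h
  have h2 := S.testWork_mono j h
  have h3 := S.untestedWork_mono j h
  unfold work at h1
  rw [← NNReal.coe_le_coe] at *
  push_cast at *
  linarith

theorem isClosed_tested (S : Schedule I) (j : Fin n) : IsClosed {s | S.Tested j s} :=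
  isClosed_le continuous_const (S.continuous_testWork j)

theorem isClosed_untested (S : Schedule I) (j : Fin n) :
    IsClosed {s | I.u j ≤ S.untestedWork j s} :=
  isClosed_le continuous_const (S.continuous_untestedWork j)

theorem isClosed_finished (S : Schedule I) (j : Fin n) : IsClosed {s | S.Finished j s} :=
  (S.isClosed_untested j).union
    ((S.isClosed_tested j).inter
      (isClosed_Ici.preimage (S.continuous_execWork j) : IsClosed {s | I.p j ≤ S.execWork j s}))

theorem exists_finished (S : Schedule I) (h : S.cost ≠ ∞) (j : Fin n) : ∃ s, S.Finished j s := by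
  by_contra! hj
  refine h (ENNReal.sum_eq_top.2 ⟨j, Finset.mem_univ j, ?_⟩)
  simp [completionTime, hj]

theorem exists_completionTime (S : Schedule I) (h : S.cost ≠ ∞) (j : Fin n) :
    ∃ s : ℝ≥0, S.completionTime j = s ∧ S.Finished j s ∧ ∀ s', S.Finished j s' → s ≤ s' := by
  have hmem := (S.isClosed_finished j).csInf_mem (S.exists_finished h j) (OrderBot.bddBelow _)
  have hmin : ∀ s', S.Finished j s' → sInf {s | S.Finished j s} ≤ s' := fun s' hs' =>
    csInf_le (OrderBot.bddBelow _) hs'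
  refine ⟨_, le_antisymm (iInf₂_le _ hmem) (le_iInf₂ fun s hs => ?_), hmem, hmin⟩
  exact_mod_cast hmin s hs

/-- Every job is handled at some time: its test or its untested run is finished. There is a first
such time. -/
theorem exists_first_handled (S : Schedule I) (h : S.cost ≠ ∞) (j : Fin n) :
    ∃ s : ℝ≥0, (S.Tested j s ∨ I.u j ≤ S.untestedWork j s) ∧
      ∀ s' < s, ¬ S.Tested j s' ∧ S.untestedWork j s' < I.u j := by
  have hne : ({s | S.Tested j s} ∪ {s | I.u j ≤ S.untestedWork j s}).Nonempty := by
    obtain ⟨s, hs | hs⟩ := S.exists_finished h j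
    · exact ⟨s, Or.inr hs⟩
    · exact ⟨s, Or.inl hs.1⟩
  have hmem := ((S.isClosed_tested j).union (S.isClosed_untested j)).csInf_mem hne
    (OrderBot.bddBelow _)
  refine ⟨_, hmem, fun s' hs' => ?_⟩
  have := notMem_of_lt_csInf hs' (OrderBot.bddBelow _)
  simpa [not_or] using this

end Schedule

/-! ### Upper bound on the optimum -/

/-- Jobs of lengths `d i` run back to back keep the machine busy until all are done; this supplies
the hypothesis of `sequentialSchedule`. -/
theorem sum_min_tsub_sum (d : ℕ → ℝ≥0) (s : ℝ≥0) (m : ℕ) :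
    ∑ i ∈ Finset.range m, min (d i) (s - ∑ k ∈ Finset.range i, d k) =
      min (∑ i ∈ Finset.range m, d i) s := by
  induction m with
  | zero => simp
  | succ m ih =>
    rw [Finset.sum_range_succ, ih, Finset.sum_range_succ]
    generalize ∑ i ∈ Finset.range m, d i = D
    rcases le_total D s with h | h
    · rw [min_eq_left h, ← min_add_add_left, add_tsub_cancel_of_le h]
    · rw [min_eq_right h, tsub_eq_zero_of_le h, min_eq_right zero_le, add_zero,
        min_eq_right (h.trans le_self_add)]

theorem two_mul_sum_range_sum_range_succ (g : ℕ → ℕ → ℝ≥0) (hg : ∀ i k, g i k = g k i) (m : ℕ) :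
    2 * ∑ i ∈ Finset.range m, ∑ k ∈ Finset.range (i + 1), g i k =
      ∑ i ∈ Finset.range m, ∑ k ∈ Finset.range m, g i k + ∑ i ∈ Finset.range m, g i i := by
  induction m with
  | zero => simp
  | succ m ih =>
    have h : ∑ i ∈ Finset.range m, g i m = ∑ k ∈ Finset.range m, g m k :=
      Finset.sum_congr rfl fun i _ => hg i m
    simp only [Finset.sum_range_succ _ m, Finset.sum_add_distrib, mul_add, ih, h]
    ring

/-- The schedule that processes the jobs one after the other, where job `j` starts at time
`start j` and occupies the machine for its testing time if `test j` holds, and for its upper bound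
otherwise. -/
def sequentialSchedule {n : ℕ} (I : Instance n) (test : Fin n → Prop) [DecidablePred test]
    (start : Fin n → ℝ≥0) (D : ℝ≥0)
    (h : ∀ s, ∑ j, min (if test j then I.t j else I.u j) (s - start j) = min D s) :
    Schedule I where
  testWork j s := if test j then min (I.t j) (s - start j) else 0
  untestedWork j s := if test j then 0 else min (I.u j) (s - start j)
  execWork _ _ := 0
  testWork_zero j := by simp
  untestedWork_zero j := by simp
  execWork_zero _ := rfl
  testWork_mono j s s' hs := by
    dsimp only
    split_ifs
    · gcongr
    · rfl
  untestedWork_mono j s s' hs := by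
    dsimp only
    split_ifs
    · rfl
    · gcongr
  execWork_mono _ := monotone_const
  unit_speed s s' hs := by
    have key : ∀ s, ∑ j, ((if test j then min (I.t j) (s - start j) else 0) +
        (if test j then 0 else min (I.u j) (s - start j)) + 0) = min D s := by
      intro s
      rw [← h s]
      refine Finset.sum_congr rfl fun j _ => ?_
      split_ifs <;> simp
    rw [key, key]
    rcases le_total D s with h1 | h1
    · rw [min_eq_left h1, min_eq_left (h1.trans hs)]
      gcongr
    · rw [min_eq_right h1, add_comm s]
      gcongr
      exact min_le_right _ _
  exec_after_test _ _ _ := rfl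

/-- If the tested jobs have processing time zero, then the shortest-first schedule bounds the
optimum. -/
theorem two_mul_opt_le {n : ℕ} (I : Instance n) (test : Fin n → Prop) [DecidablePred test]
    (hp : ∀ j, test j → I.p j = 0) (d : Fin n → ℝ≥0)
    (hd : ∀ j, d j = if test j then I.t j else I.u j) :
    2 * I.opt ≤ ((∑ j, ∑ k, min (d j) (d k) + ∑ j, d j : ℝ≥0) : ℝ≥0∞) := by
  set σ := Tuple.sort d with hσ
  have hmono : Monotone (d ∘ σ) := Tuple.monotone_sort d
  set e : ℕ → ℝ≥0 := fun i => if h : i < n then d (σ ⟨i, h⟩) else 0 with he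
  have hei : ∀ i : Fin n, e i = d (σ i) := fun i => by simp [he]
  have hsum : ∀ g : Fin n → ℕ → ℝ≥0, ∀ g' : ℕ → ℝ≥0, (∀ j, g j (σ.symm j) = g' (σ.symm j)) →
      ∑ j, g j (σ.symm j) = ∑ i ∈ Finset.range n, g' i := by
    intro g g' hg
    rw [← Fin.sum_univ_eq_sum_range, ← Equiv.sum_comp σ.symm fun i : Fin n => g' i]
    exact Finset.sum_congr rfl fun j _ => hg j
  have hdj : ∀ j, d j = e (σ.symm j) := fun j => by simp [hei]
  set start : Fin n → ℝ≥0 := fun j => ∑ k ∈ Finset.range (σ.symm j), e k with hstart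
  have htot : ∀ s, ∑ j, min (if test j then I.t j else I.u j) (s - start j) =
      min (∑ i ∈ Finset.range n, e i) s := by
    intro s
    rw [← sum_min_tsub_sum]
    refine hsum (fun j i => min (if test j then I.t j else I.u j)
      (s - ∑ k ∈ Finset.range i, e k)) _ fun j => ?_
    rw [← hd, hdj]
  set S := sequentialSchedule I test start _ htot with hS
  have hC : ∀ j, S.completionTime j ≤ ((∑ k ∈ Finset.range (σ.symm j + 1), e k : ℝ≥0) : ℝ≥0∞) := by
    intro j
    refine iInf₂_le _ ?_
    have hsub : ∑ k ∈ Finset.range (σ.symm j + 1), e k - start j = d j := by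
      rw [Finset.sum_range_succ, hstart, add_tsub_cancel_left, ← hdj]
    by_cases hj : test j
    · right
      have hdt : d j = I.t j := by rw [hd, if_pos hj]
      refine ⟨?_, ?_⟩
      · simp [Schedule.Tested, hS, sequentialSchedule, hj, hsub, hdt]
      · rw [hp j hj]
        exact zero_le
    · left
      have hdt : d j = I.u j := by rw [hd, if_neg hj]
      simp [hS, sequentialSchedule, hj, hsub, hdt]
  have hcost : I.opt ≤ ((∑ i ∈ Finset.range n, ∑ k ∈ Finset.range (i + 1), e k : ℝ≥0) : ℝ≥0∞) := by
    refine (iInf_le _ S).trans ((Finset.sum_le_sum fun j _ => hC j).trans (le_of_eq ?_))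
    rw [← ENNReal.ofNNReal_finsetSum]
    congr 1
    exact hsum (fun _ i => ∑ k ∈ Finset.range (i + 1), e k) _ fun _ => rfl
  -- Writing `e k` as a minimum makes the summand symmetric, so the triangle can be completed to a
  -- square and the sorting permutation disappears.
  have hmin : ∑ i ∈ Finset.range n, ∑ k ∈ Finset.range (i + 1), e k =
      ∑ i ∈ Finset.range n, ∑ k ∈ Finset.range (i + 1), min (e i) (e k) := by
    refine Finset.sum_congr rfl fun i hi => Finset.sum_congr rfl fun k hk => ?_
    rw [Finset.mem_range] at hi hk
    rw [min_eq_right]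
    have hkn : k < n := by omega
    simp only [he, hi, hkn, dif_pos]
    exact hmono (by rw [Fin.mk_le_mk]; omega)
  calc 2 * I.opt ≤ 2 * ((∑ i ∈ Finset.range n, ∑ k ∈ Finset.range (i + 1), e k : ℝ≥0) : ℝ≥0∞) := by
        gcongr
    _ = ((∑ j, ∑ k, min (d j) (d k) + ∑ j, d j : ℝ≥0) : ℝ≥0∞) := by
        rw [hmin]
        norm_cast
        rw [two_mul_sum_range_sum_range_succ _ fun i k => min_comm _ _]
        congr 1
        · symm
          refine hsum (fun j _ => ∑ k, min (d j) (d k)) _ fun j => ?_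
          refine hsum (fun k _ => min (d j) (d k)) _ fun k => ?_
          rw [hdj j, hdj k]
        · symm
          refine hsum (fun j _ => d j) _ fun j => ?_
          rw [hdj j, min_self]


/-! ### The adversary -/

/-- The instance with unit testing times and uniform upper bound `u` in which the jobs in `B` have
processing time `u`, and all other jobs have processing time zero. -/
def twoValuedInstance {n : ℕ} (u : ℝ≥0) (B : Finset (Fin n)) : Instance n where
  t _ := 1
  u _ := u
  p j := if j ∈ B then u else 0
  p_le_u j := by split_ifs <;> simp

/-- The minimum of two lengths exceeds 1, by `u - 1`, only if both jobs lie in `B`. The diagonal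
term is of lower order and is bounded crudely. -/
theorem two_mul_opt_twoValuedInstance_le {n : ℕ} {u : ℝ≥0} (hu : 1 ≤ u) (hu2 : u ≤ 2)
    (B : Finset (Fin n)) :
    2 * (twoValuedInstance u B).opt ≤
      ((n ^ 2 + (u - 1) * B.card ^ 2 + 2 * n : ℝ≥0) : ℝ≥0∞) := by
  refine (two_mul_opt_le _ (fun j => j ∉ B) (fun j hj => if_neg hj)
    (fun j => if j ∉ B then 1 else u) fun j => rfl).trans ?_
  rw [ENNReal.coe_le_coe]
  refine add_le_add (le_of_eq ?_) ?_
  · have h : ∀ j k : Fin n, min (if j ∉ B then 1 else u) (if k ∉ B then 1 else u) =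
        1 + (u - 1) * ((if j ∈ B then 1 else 0) * (if k ∈ B then 1 else 0)) := by
      intro j k
      by_cases hj : j ∈ B <;> by_cases hk : k ∈ B <;> simp [hj, hk, hu]
    simp_rw [h, Finset.sum_add_distrib, ← Finset.mul_sum, ← Finset.sum_mul]
    simp [sq]
  · calc ∑ j, (if j ∉ B then 1 else u) ≤ ∑ j : Fin n, (2 : ℝ≥0) := by
          refine Finset.sum_le_sum fun j _ => ?_
          by_cases hj : j ∈ B
          · simpa [hj] using hu2
          · simp [hj]
      _ = 2 * n := by simp [mul_comm]

/-- In the schedule `S`, at time `T`, the jobs in `A` have been run untested without a completed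
test, the jobs in `B` have been tested before their untested run was finished, and no other job
had been tested or run untested before time `T`. -/
structure HandledAt {n : ℕ} {I : Instance n} (S : Schedule I) (A B : Finset (Fin n)) (T : ℝ≥0) :
    Prop where
  untested : ∀ j ∈ A, ∃ s ≤ T, ¬ S.Tested j s ∧ I.u j ≤ S.untestedWork j s
  tested : ∀ j ∈ B, S.Tested j T ∧ ∀ s ≤ T, I.u j ≤ S.untestedWork j s → S.Tested j s
  unhandled : ∀ j, j ∉ A → j ∉ B → ∀ s < T, ¬ S.Tested j s ∧ S.untestedWork j s < I.u j

theorem Schedule.Tested.mono {n : ℕ} {I : Instance n} {S : Schedule I} {j : Fin n} {s s' : ℝ≥0}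
    (h : S.Tested j s) (hs : s ≤ s') : S.Tested j s' :=
  le_trans h (S.testWork_mono j hs)

/-- The adversary can answer the first `k` jobs handled by the algorithm with processing time `u`
if they are tested, and with processing time zero otherwise. -/
theorem PreemptiveAlgorithm.exists_handledAt (A : PreemptiveAlgorithm) {n : ℕ} (u : ℝ≥0)
    (hfin : ∀ B : Finset (Fin n), (A.schedule (twoValuedInstance u B)).cost ≠ ∞) (k : ℕ)
    (hk : k ≤ n) :
    ∃ (U B : Finset (Fin n)) (T : ℝ≥0), Disjoint U B ∧ U.card + B.card = k ∧
      HandledAt (A.schedule (twoValuedInstance u B)) U B T := by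
  induction k with
  | zero =>
    refine ⟨∅, ∅, 0, disjoint_bot_left, rfl, by simp, by simp, fun j _ _ s hs => ?_⟩
    exact absurd hs not_lt_zero
  | succ k ih =>
    obtain ⟨U, B, T, hUB, hcard, hH⟩ := ih (by omega)
    have hR : (U ∪ B)ᶜ.Nonempty := by
      rw [← Finset.card_pos, Finset.card_compl, Finset.card_union_of_disjoint hUB, Fintype.card_fin]
      omega
    set S := A.schedule (twoValuedInstance u B) with hS
    choose h hh hlt using S.exists_first_handled (hfin B)
    -- The next handled job. Ties are harmless, since `unhandled` concerns only times strictly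
    -- before `T`.
    obtain ⟨i, hi, hmin⟩ := Finset.exists_min_image _ h hR
    have hiU : i ∉ U := by
      intro hc; simp [hc] at hi
    have hiB : i ∉ B := by
      intro hc; simp [hc] at hi
    have hTi : T ≤ h i := by
      by_contra! hc
      have := hH.unhandled i hiU hiB _ hc
      rcases hh i with h1 | h1
      · exact this.1 h1
      · exact absurd h1 this.2.not_ge
    have hun : ∀ j, j ∉ U → j ∉ B → ∀ s < h i,
        ¬ S.Tested j s ∧ S.untestedWork j s < (twoValuedInstance u B).u j :=
      fun j hj hj' s hs => hlt j s (hs.trans_le (hmin j (by simp [hj, hj'])))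
    have hB : ∀ j ∈ B, S.Tested j (h i) ∧
        ∀ s ≤ h i, (twoValuedInstance u B).u j ≤ S.untestedWork j s → S.Tested j s := by
      intro j hj
      have hT := (hH.tested j hj).1
      refine ⟨hT.mono hTi, fun s _ hus => ?_⟩
      rcases le_total s T with h1 | h1
      · exact (hH.tested j hj).2 s h1 hus
      · exact hT.mono h1
    have hU : ∀ j ∈ U, ∃ s ≤ h i, ¬ S.Tested j s ∧
        (twoValuedInstance u B).u j ≤ S.untestedWork j s := by
      intro j hj
      obtain ⟨s, hs, h1⟩ := hH.untested j hj
      exact ⟨s, hs.trans hTi, h1⟩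
    by_cases hit : S.Tested i (h i)
    -- Raising the processing time of `i` cannot be noticed before its test ends at `h i`, so both
    -- schedules agree up to and including `h i`.
    · have hagree := A.nonanticipating (twoValuedInstance u B) (twoValuedInstance u (insert i B))
        rfl rfl (h i) (by
          intro j s hs hj
          have hji : j ≠ i := by
            rintro rfl
            exact (hlt j s hs).1 hj
          simp [twoValuedInstance, hji])
      rw [← hS] at hagree
      set S' := A.schedule (twoValuedInstance u (insert i B)) with hS'
      have htest : ∀ s ≤ h i, ∀ j, S'.Tested j s ↔ S.Tested j s := by
        intro s hs j
        have := (hagree s hs j).1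
        unfold Schedule.Tested
        rw [this]
        rfl
      have hunt : ∀ s ≤ h i, ∀ j, S'.untestedWork j s = S.untestedWork j s := fun s hs j =>
        (hagree s hs j).2.1.symm
      refine ⟨U, insert i B, h i, ?_, ?_, ?_, ?_, ?_⟩
      · exact Finset.disjoint_insert_right.2 ⟨hiU, hUB⟩
      · rw [Finset.card_insert_of_notMem hiB]
        omega
      · intro j hj
        obtain ⟨s, hs, h1, h2⟩ := hU j hj
        refine ⟨s, hs, ?_, ?_⟩
        · rwa [htest s hs]
        · rw [hunt s hs]
          exact h2
      · intro j hj
        rw [htest _ le_rfl]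
        rcases Finset.mem_insert.1 hj with rfl | hj
        · refine ⟨hit, fun s hs hus => ?_⟩
          rw [htest s hs]
          rcases hs.lt_or_eq with h1 | rfl
          · rw [hunt s hs] at hus
            exact absurd hus (hlt j s h1).2.not_ge
          · exact hit
        · refine ⟨(hB j hj).1, fun s hs hus => ?_⟩
          rw [htest s hs]
          rw [hunt s hs] at hus
          exact (hB j hj).2 s hs hus
      · intro j hjU hjB s hs
        rw [htest s hs.le, hunt s hs.le]
        exact hun j hjU (fun hc => hjB (Finset.mem_insert_of_mem hc)) s hs
    · refine ⟨insert i U, B, h i, ?_, ?_, ?_, hB, ?_⟩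
      · exact Finset.disjoint_insert_left.2 ⟨hiB, hUB⟩
      · rw [Finset.card_insert_of_notMem hiU]
        omega
      · intro j hj
        rcases Finset.mem_insert.1 hj with rfl | hj
        · exact ⟨h j, le_rfl, hit, (hh j).resolve_left hit⟩
        · exact hU j hj
      · intro j hjU hjB s hs
        exact hun j (fun hc => hjU (Finset.mem_insert_of_mem hc)) hjB s hs

/-! ### Lower bound on the algorithm's cost -/

/-- Summing the work done by each completion time and symmetrizing reduces the cost to mutual delays
of pairs. -/
theorem sum_le_two_mul_sum_of_pairwise {n : ℕ} {w : Fin n → ℝ → ℝ} {C : Fin n → ℝ}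
    (hw : ∀ j, ∑ k, w k (C j) ≤ C j) {m : Fin n → Fin n → ℝ}
    (hm : ∀ j k, m j k ≤ w j (C k) + w k (C j)) : ∑ j, ∑ k, m j k ≤ 2 * ∑ j, C j := by
  calc ∑ j, ∑ k, m j k ≤ ∑ j, ∑ k, (w j (C k) + w k (C j)) :=
        Finset.sum_le_sum fun j _ => Finset.sum_le_sum fun k _ => hm j k
    _ = ∑ j, ∑ k, w j (C k) + ∑ j, ∑ k, w k (C j) := by simp_rw [Finset.sum_add_distrib]
    _ = ∑ j, ∑ k, w k (C j) + ∑ j, ∑ k, w k (C j) := by rw [Finset.sum_comm]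
    _ ≤ 2 * ∑ j, C j := by
        rw [two_mul]
        exact add_le_add (Finset.sum_le_sum fun j _ => hw j) (Finset.sum_le_sum fun j _ => hw j)

/-- The lower bound on the cost of a schedule, where `z` of the jobs in `B` are completed
by the time `T`, and `y` of them later. -/
theorem HandledAt.exists_card_le_cost {n : ℕ} {u : ℝ≥0} (hu : 1 ≤ u) {U B : Finset (Fin n)}
    {T : ℝ≥0} {S : Schedule (twoValuedInstance u B)} (hH : HandledAt S U B T)
    (hUB : Disjoint U B) (hfin : S.cost ≠ ∞) :
    ∃ z y : ℕ, z + y = B.card ∧ ∀ a c : ℝ, a = U.card → a + z + y + c = n →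
      u * a * (2 * n - a) + (1 + u) * z ^ 2 + 2 * (1 + u) * z * (c + y) + c ^ 2 + 4 * c * y +
        (2 + u) * y ^ 2 ≤ 2 * S.cost.toReal := by
  classical
  choose C hC hF hmin using S.exists_completionTime hfin
  have hu' : (1 : ℝ) ≤ u := by exact_mod_cast hu
  have hwm : ∀ j {s s' : ℝ≥0}, s ≤ s' → (S.work j s : ℝ) ≤ S.work j s' := fun j s s' h => by
    exact_mod_cast S.work_mono j h
  have hw0 : ∀ j s, (0 : ℝ) ≤ S.work j s := fun j s => NNReal.coe_nonneg _
  -- the untested jobs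
  have hUT : ∀ j ∈ U, C j ≤ T ∧ (u : ℝ) ≤ S.work j (C j) := by
    intro j hj
    obtain ⟨s, hs, h1, h2⟩ := hH.untested j hj
    have h3 : C j ≤ s := hmin j s (Or.inl h2)
    refine ⟨h3.trans hs, ?_⟩
    rcases hF j with h4 | h4
    · have h4' : (u : ℝ) ≤ S.untestedWork j (C j) := by exact_mod_cast h4
      have := NNReal.coe_nonneg (S.testWork j (C j))
      have := NNReal.coe_nonneg (S.execWork j (C j))
      simp only [Schedule.work]
      push_cast
      linarith
    · exact absurd (h4.1.mono h3) h1
  -- the tested jobs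
  have hBT : ∀ j ∈ B, ∀ s, T ≤ s → (1 : ℝ) ≤ S.work j s := by
    intro j hj s hs
    have h1 : (1 : ℝ) ≤ S.testWork j s := by exact_mod_cast (hH.tested j hj).1.mono hs
    have := NNReal.coe_nonneg (S.untestedWork j s)
    have := NNReal.coe_nonneg (S.execWork j s)
    simp only [Schedule.work]
    push_cast
    linarith
  have hBC : ∀ j ∈ B, (1 + u : ℝ) ≤ S.work j (C j) := by
    intro j hj
    obtain ⟨h1, h2⟩ := hH.tested j hj
    have h3 : S.Tested j (C j) := by
      rcases hF j with h4 | h4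
      · rcases le_total (C j) T with h5 | h5
        · exact h2 _ h5 h4
        · exact h1.mono h5
      · exact h4.1
    have h3' : (1 : ℝ) ≤ S.testWork j (C j) := by exact_mod_cast h3
    have g1 := NNReal.coe_nonneg (S.untestedWork j (C j))
    have g2 := NNReal.coe_nonneg (S.execWork j (C j))
    have h6 : (u : ℝ) ≤ S.untestedWork j (C j) + S.execWork j (C j) := by
      rcases hF j with h4 | h4
      · have h4' : (u : ℝ) ≤ S.untestedWork j (C j) := by exact_mod_cast h4
        linarith
      · have h5 := h4.2
        simp only [twoValuedInstance, hj, if_true] at h5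
        have h5' : (u : ℝ) ≤ S.execWork j (C j) := by exact_mod_cast h5
        linarith
    simp only [Schedule.work]
    push_cast
    linarith
  -- the remaining jobs
  have hRT : ∀ j, j ∉ U → j ∉ B → T ≤ C j ∧ (1 : ℝ) ≤ S.work j (C j) := by
    intro j hjU hjB
    constructor
    · by_contra! hc
      obtain ⟨h1, h2⟩ := hH.unhandled j hjU hjB _ hc
      rcases hF j with h4 | h4
      · exact absurd h4 h2.not_ge
      · exact h1 h4.1
    · have g0 := NNReal.coe_nonneg (S.testWork j (C j))
      have g1 := NNReal.coe_nonneg (S.untestedWork j (C j))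
      have g2 := NNReal.coe_nonneg (S.execWork j (C j))
      simp only [Schedule.work]
      push_cast
      rcases hF j with h4 | h4
      · have h4' : (u : ℝ) ≤ S.untestedWork j (C j) := by exact_mod_cast h4
        linarith
      · have h4' : (1 : ℝ) ≤ S.testWork j (C j) := by exact_mod_cast h4.1
        linarith
  set Z := B.filter fun j => C j ≤ T with hZ
  set Y := B.filter fun j => ¬ C j ≤ T with hY
  -- Indicators of the four types: untested, tested and done by `T`, tested and done later, and the
  -- rest. They turn the pair bounds into a form whose double sum is a polynomial in the
  -- cardinalities.
  let a : Fin n → ℝ := fun j => if j ∈ U then 1 else 0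
  let z : Fin n → ℝ := fun j => if j ∈ Z then 1 else 0
  let y : Fin n → ℝ := fun j => if j ∈ Y then 1 else 0
  let r : Fin n → ℝ := fun j => 1 - a j - z j - y j
  have hsuma : ∑ j, a j = U.card := by simp [a]
  have hsumz : ∑ j, z j = Z.card := by simp [z]
  have hsumy : ∑ j, y j = Y.card := by simp [y]
  have hsumr : ∑ j, r j = n - U.card - Z.card - Y.card := by
    simp only [r, Finset.sum_sub_distrib, hsuma, hsumz, hsumy]
    simp
  have hcases : ∀ j, (j ∈ U ∧ a j = 1 ∧ z j = 0 ∧ y j = 0 ∧ r j = 0) ∨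
      (j ∈ B ∧ C j ≤ T ∧ a j = 0 ∧ z j = 1 ∧ y j = 0 ∧ r j = 0) ∨
      (j ∈ B ∧ T ≤ C j ∧ a j = 0 ∧ z j = 0 ∧ y j = 1 ∧ r j = 0) ∨
      (j ∉ U ∧ j ∉ B ∧ a j = 0 ∧ z j = 0 ∧ y j = 0 ∧ r j = 1) := by
    intro j
    by_cases hjU : j ∈ U
    · have hjB : j ∉ B := Finset.disjoint_left.1 hUB hjU
      simp [a, z, y, r, hZ, hY, hjU, hjB]
    · by_cases hjB : j ∈ B
      · by_cases hjT : C j ≤ T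
        · simp [a, z, y, r, hZ, hY, hjU, hjB, hjT]
        · simp [a, z, y, r, hZ, hY, hjU, hjB, not_le.1 hjT, (not_le.1 hjT).le]
      · simp [a, z, y, r, hZ, hY, hjU, hjB]
  -- The earlier finisher contributes its full work. A late job of `B` adds at least its test of
  -- length 1 when the other job finishes at or after `T`.
  have hpair : ∀ j k, u * (a j + a k - a j * a k) +
      (1 + u) * (z j * z k + z j * (r k + y k) + z k * (r j + y j)) + r j * r k +
      2 * (r j * y k + y j * r k) + (2 + u) * (y j * y k) ≤
      S.work j (C k) + S.work k (C j) := by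
    have hle : ∀ j k, C j ≤ C k → u * (a j + a k - a j * a k) +
      (1 + u) * (z j * z k + z j * (r k + y k) + z k * (r j + y j)) + r j * r k +
      2 * (r j * y k + y j * r k) + (2 + u) * (y j * y k) ≤
      S.work j (C k) + S.work k (C j) := by
      intro j k hjk
      have h1 := hwm j hjk
      have h2 := hw0 k (C j)
      have h2' : C k = C j → S.work k (C j) = S.work k (C k) := fun h => by rw [h]
      rcases hcases j with ⟨hj, e1, e2, e3, e4⟩ | ⟨hj, hjT, e1, e2, e3, e4⟩ |
        ⟨hj, hjT, e1, e2, e3, e4⟩ | ⟨hj, hj', e1, e2, e3, e4⟩ <;>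
      rcases hcases k with ⟨hk, f1, f2, f3, f4⟩ | ⟨hk, hkT, f1, f2, f3, f4⟩ |
        ⟨hk, hkT, f1, f2, f3, f4⟩ | ⟨hk, hk', f1, f2, f3, f4⟩ <;>
      rw [e1, e2, e3, e4, f1, f2, f3, f4]
      · linarith [hUT j hj]
      · linarith [hUT j hj]
      · linarith [hUT j hj]
      · linarith [hUT j hj]
      · linarith [hBC j hj]
      · linarith [hBC j hj]
      · linarith [hBC j hj]
      · linarith [hBC j hj]
      · linarith [hBC j hj]
      -- The types force the opposite order, so both jobs complete exactly at `T`.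
      · have : C k = C j := le_antisymm (hkT.trans hjT) hjk
        linarith [hBC j hj]
      · linarith [hBC j hj, hBT k hk _ hjT]
      · linarith [hBC j hj]
      · have : C k = C j := le_antisymm ((hUT k hk).1.trans (hRT j hj hj').1) hjk
        rw [this] at h1 ⊢
        have h3 := (hUT k hk).2
        rw [this] at h3
        linarith [hw0 j (C j)]
      · have : C k = C j := le_antisymm (hkT.trans (hRT j hj hj').1) hjk
        rw [this] at h1 ⊢
        have h3 := hBC k hk
        rw [this] at h3
        linarith [hw0 j (C j)]
      · linarith [(hRT j hj hj').2, hBT k hk _ (hRT j hj hj').1]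
      · linarith [(hRT j hj hj').2]
    intro j k
    rcases le_total (C j) (C k) with h | h
    · exact hle j k h
    · have := hle k j h
      linarith
  refine ⟨Z.card, Y.card, Finset.card_filter_add_card_filter_not _, fun a' c ha hc => ?_⟩
  have hcost : S.cost.toReal = ∑ j, (C j : ℝ) := by
    simp only [Schedule.cost, hC]
    rw [← ENNReal.ofNNReal_finsetSum, ENNReal.coe_toReal, NNReal.coe_sum]
  have hmain := sum_le_two_mul_sum_of_pairwise (w := fun j s => S.work j s.toNNReal)
    (C := fun j => (C j : ℝ)) (fun j => by
      have := S.sum_work_le (C j)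
      simp only [Real.toNNReal_coe]
      exact_mod_cast this) (fun j k => by simpa only [Real.toNNReal_coe] using hpair j k)
  rw [hcost]
  refine le_trans (le_of_eq ?_) hmain
  simp only [mul_add, mul_sub, Finset.sum_add_distrib, Finset.sum_sub_distrib, ← Finset.mul_sum,
    ← Finset.sum_mul, hsuma, hsumz, hsumy, hsumr, Finset.sum_const, Finset.card_univ,
    Fintype.card_fin, nsmul_eq_mul]
  obtain rfl : c = n - U.card - Z.card - Y.card := by rw [← hc, ha]; ring
  rw [ha]
  ring

/-! ### Numerical conclusion -/

theorem quadratic_bound (z y : ℝ) (hz : 0 ≤ z) (hy : 0 ≤ y) (h : z + y ≤ 0.6307) :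
    (1.85462 : ℝ) * (1 + 0.9896 * (z + y) ^ 2) ≤
      1.9896 * (0.6307 - (z + y)) * (2 - (0.6307 - (z + y))) + 2.9896 * z ^ 2 +
      2 * 2.9896 * z * (0.3693 + y) + 0.3693 ^ 2 + 4 * 0.3693 * y + 3.9896 * y ^ 2 := by
  obtain ⟨b, rfl⟩ : ∃ b, y = b - z := ⟨z + y, by ring⟩
  rw [show z + (b - z) = b by ring] at *
  have hb : 0 ≤ b := by linarith
  -- For fixed `b` the right side is a monic quadratic in `z` with vertex `b - 0.9896 * 0.3693`; a
  -- negative vertex makes `z = 0` the minimizer.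
  rcases le_total b (0.9896 * 0.3693) with hc | hc
  · nlinarith [mul_nonneg hz (sub_nonneg.2 hc), sq_nonneg z, sq_nonneg b]
  · nlinarith [sq_nonneg (z - (b - 0.9896 * 0.3693)),
      mul_nonneg (sub_nonneg.2 hc) (sub_nonneg.2 h)]

theorem opt_twoValuedInstance_ne_top {n : ℕ} {u : ℝ≥0} (hu : 1 ≤ u) (hu2 : u ≤ 2)
    (B : Finset (Fin n)) : (twoValuedInstance u B).opt ≠ ∞ := by
  intro h
  have h1 := two_mul_opt_twoValuedInstance_le hu hu2 B
  rw [h, ENNReal.mul_top two_ne_zero] at h1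
  exact ENNReal.coe_ne_top (top_le_iff.1 h1)

end SchedulingWithTesting
/-- No deterministic preemptive algorithm for scheduling with testing on a single machine is
better than `1.8546`-competitive for the sum of completion times. -/
theorem theorem3 (A : SchedulingWithTesting.PreemptiveAlgorithm) (c : ℝ)
    (hc : A.IsCompetitive c) : (1.8546 : ℝ) ≤ c := by
  open SchedulingWithTesting in
  by_contra! hlt
  -- Large enough for the gap between 1.85462 and 1.8546, times `n²`, to absorb the term `2 * n` in
  -- the bound on the optimum.
  obtain ⟨n, hn⟩ : ∃ n : ℕ, n = 1000000 := ⟨_, rfl⟩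
  obtain ⟨u, hu⟩ : ∃ u : ℝ≥0, (u : ℝ) = 1.9896 := ⟨⟨1.9896, by norm_num⟩, rfl⟩
  have hu1 : 1 ≤ u := by
    rw [← NNReal.coe_le_coe, hu]
    norm_num
  have hu2 : u ≤ 2 := by
    rw [← NNReal.coe_le_coe, hu]
    norm_num
  have hopt : ∀ B : Finset (Fin n), (twoValuedInstance u B).opt ≠ ∞ :=
    opt_twoValuedInstance_ne_top hu1 hu2
  have hfin : ∀ B : Finset (Fin n), (A.schedule (twoValuedInstance u B)).cost ≠ ∞ := fun B =>
    ne_top_of_le_ne_top (ENNReal.mul_ne_top ENNReal.ofReal_ne_top (hopt B)) (hc n _)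
  obtain ⟨U, B, T, hUB, hcard, hH⟩ := A.exists_handledAt u hfin 630700 (by omega)
  obtain ⟨z, y, hzy, hcost⟩ := hH.exists_card_le_cost hu1 hUB (hfin B)
  have halg := hcost U.card 369300 rfl (by norm_cast; omega)
  have hcomp : (A.schedule (twoValuedInstance u B)).cost.toReal ≤
      1.8546 * (twoValuedInstance u B).opt.toReal := by
    have h := (hc n (twoValuedInstance u B)).trans
      (mul_le_mul_left (ENNReal.ofReal_le_ofReal hlt.le) _)
    have h' := ENNReal.toReal_mono (ENNReal.mul_ne_top ENNReal.ofReal_ne_top (hopt B)) h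
    rwa [ENNReal.toReal_mul, ENNReal.toReal_ofReal (by norm_num)] at h'
  have hopt_le := ENNReal.toReal_mono ENNReal.coe_ne_top
    (two_mul_opt_twoValuedInstance_le hu1 hu2 B)
  rw [ENNReal.toReal_mul, ENNReal.coe_toReal] at hopt_le
  have hsub : ((u - 1 : ℝ≥0) : ℝ) = 0.9896 := by
    rw [NNReal.coe_sub hu1, hu]
    norm_num
  have hBr : (B.card : ℝ) = z + y := by exact_mod_cast hzy.symm
  have hUr : (U.card : ℝ) = 630700 - (z + y) := by
    rw [← hBr, eq_sub_iff_add_eq]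
    exact_mod_cast hcard
  have hn' : (n : ℝ) = 1000000 := by exact_mod_cast hn
  push_cast at hopt_le
  rw [hsub, hBr, hn'] at hopt_le
  rw [hu, hUr, hn'] at halg
  have hle : (z : ℝ) + y ≤ 630700 := by
    have := Nat.cast_nonneg (α := ℝ) U.card
    linarith
  have hq := quadratic_bound (z / 1000000) (y / 1000000) (by positivity) (by positivity)
    (by linarith)
  norm_num at hopt_le
  nlinarith
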